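/- **Theorem 1.2.** There is a Köthe sequence space that supports a frequently hypercyclic weighted shift but no chaotic weighted shift. More precisely, let $\mathbb K=\mathbb R$ or $\mathbb C$. There are integers $0=N_0<N_1<N_2<\cdots$ with $N_{k+1}-N_k\to\infty$ and a nondecreasing sequence $(\alpha_n)_{n\ge 0}$ of positive real numbers tending to $+\infty$ with $\alpha_0=1$, $$\alpha_{N_k}=\alpha_0+\cdots+\alpha_{N_k-1}\quad(k\ge 1),\qquad \alpha_{n+1}=\alpha_n\quad\text{whenever } n+1\notin\{N_k: k\ge 1\},$$ such that the power series space of order $0$ and infinite type $$\mathcal C_{0,\infty}(\alpha)=\Bigl\{x=(x_n)_{n\ge 0}\in\mathbb K^{\mathbb N_0}:\ \forall p\ge 1,\ p^{\alpha_n}|x_n|\xrightarrow[n\to\infty]{}0\Bigr\},\qquad \|x\|_p=\sup_{n}|x_n|\,p^{\alpha_n}\quad(p=1,2,3,\dots),$$ which is the Köthe sequence space of order $0$ of the matrix $(p^{\alpha_n})_{p\ge 1,n\ge 0}$, has the following two properties. 1. There is a sequence $w=(w_n)_{n\ge0}$ of positive real numbers such that the weighted shift $B_w(x_n)_{n\ge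 0}=(w_{n+1}x_{n+1})_{n\ge 0}$ is a continuous linear operator on $\mathcal C_{0,\infty}(\alpha)$ that is frequently hypercyclic. 2. For no sequence $w$ of positive real numbers is $B_w$ a chaotic continuous linear operator on $\mathcal C_{0,\infty}(\alpha)$. Here an operator $T$ on $X$ is frequently hypercyclic if there is $x\in X$ such that $\{n\ge 0: T^nx\in U\}$ has positive lower density, i.e. $\liminf_{N\to\infty}\frac1{N+1}\operatorname{card}\{n\le N: T^nx\in U\}>0$, for every nonempty open $U\subset X$; and $T$ is chaotic if it has a dense orbit and a dense set of periodic points. -/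

import Mathlib

open Filter Topology

noncomputable section

/-- A Köthe matrix `(a_{m,n})_{m ≥ 1, n ≥ 0}`: strictly positive numbers, nondecreasing in `m`. -/
structure KotheMatrix where
  a : ℕ+ → ℕ → ℝ
  pos : ∀ m n, 0 < a m n
  mono : ∀ m n, a m n ≤ a (m + 1) n

/-- The vector space `c_0(A)`: scalar sequences `x` with `|x_n| a_{m,n} → 0` for every `m ≥ 1`. -/
def KotheMatrix.c0Submodule (𝕜 : Type*) [RCLike 𝕜] (A : KotheMatrix) : Submodule 𝕜 (ℕ → 𝕜) where
  carrier := {x | ∀ m : ℕ+, Tendsto (fun n => ‖x n‖ * A.a m n) atTop (𝓝 0)}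
  zero_mem' := by intro m; simp
  add_mem' := by
    intro x y hx hy m
    have h := (hx m).add (hy m)
    rw [add_zero] at h
    refine squeeze_zero (fun n => mul_nonneg (norm_nonneg _) (A.pos m n).le) (fun n => ?_) h
    rw [← add_mul]
    exact mul_le_mul_of_nonneg_right (norm_add_le _ _) (A.pos m n).le
  smul_mem' := by
    intro c x hx m
    have h := (hx m).const_mul ‖c‖
    rw [mul_zero] at h
    refine h.congr (fun n => ?_)
    simp [mul_assoc]

/-- The Köthe sequence space of order `0`. It is a type of its own, so that it does not inherit
the topology of coordinatewise convergence from `ℕ → 𝕜`. -/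
def KotheC0 (𝕜 : Type*) [RCLike 𝕜] (A : KotheMatrix) : Type _ := A.c0Submodule 𝕜

namespace KotheC0

variable {𝕜 : Type*} [RCLike 𝕜] {A : KotheMatrix}

instance : AddCommGroup (KotheC0 𝕜 A) := inferInstanceAs (AddCommGroup (A.c0Submodule 𝕜))

instance : Module 𝕜 (KotheC0 𝕜 A) := inferInstanceAs (Module 𝕜 (A.c0Submodule 𝕜))

/-- The `n`-th coordinate of a sequence. -/
def coord (x : KotheC0 𝕜 A) (n : ℕ) : 𝕜 := x.1 n

theorem bddAbove (x : KotheC0 𝕜 A) (m : ℕ+) :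
    BddAbove (Set.range fun n => ‖x.coord n‖ * A.a m n) :=
  (x.2 m).bddAbove_range

/-- The seminorm `‖x‖_m = sup_n |x_n| a_{m,n}`. -/
def seminorm (𝕜 : Type*) [RCLike 𝕜] (A : KotheMatrix) (m : ℕ+) : Seminorm 𝕜 (KotheC0 𝕜 A) :=
  Seminorm.of (fun x => ⨆ n, ‖x.coord n‖ * A.a m n)
    (by
      intro x y
      refine ciSup_le fun n => ?_
      refine le_trans ?_ (add_le_add (le_ciSup (bddAbove x m) n) (le_ciSup (bddAbove y m) n))
      rw [← add_mul]
      exact mul_le_mul_of_nonneg_right (norm_add_le (x.1 n) (y.1 n)) (A.pos m n).le)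
    (by
      intro c x
      rw [Real.mul_iSup_of_nonneg (norm_nonneg c)]
      congr 1
      funext n
      rw [← mul_assoc, ← norm_mul]
      rfl)

/-- The Fréchet space topology, defined by the seminorms `‖·‖_m`, `m ≥ 1`. -/
instance : TopologicalSpace (KotheC0 𝕜 A) :=
  (SeminormFamily.moduleFilterBasis (seminorm 𝕜 A)).topology

theorem withSeminorms : WithSeminorms (seminorm 𝕜 A) := ⟨rfl⟩

end KotheC0

/-- The matrix `a_{p,n} = p ^ α_n`, where the exponents `α_n` are positive. -/
def powerSeriesMatrix (α : ℕ → ℝ) (hα : ∀ n, 0 < α n) : KotheMatrix where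
  a p n := ((p : ℕ) : ℝ) ^ α n
  pos p n := Real.rpow_pos_of_pos (by exact_mod_cast p.pos) _
  mono p n := by
    refine Real.rpow_le_rpow (Nat.cast_nonneg _) ?_ (hα n).le
    exact_mod_cast (Nat.le_succ (p : ℕ))

/-- The power series space `C_{0,∞}(α)` of order `0` and infinite type. -/
abbrev PowerSeriesC0 (𝕜 : Type*) [RCLike 𝕜] (α : ℕ → ℝ) (hα : ∀ n, 0 < α n) : Type _ :=
  KotheC0 𝕜 (powerSeriesMatrix α hα)

/-- The lower density `liminf_N card {n ≤ N : n ∈ A} / (N + 1)` of a set of natural numbers. -/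
def lowerDensity (A : Set ℕ) : ℝ :=
  liminf (fun N : ℕ => (({n | n ≤ N ∧ n ∈ A} : Set ℕ).ncard : ℝ) / ((N : ℝ) + 1)) atTop

/-- `T` has a dense orbit and a dense set of periodic points. -/
def IsChaotic {X : Type*} [TopologicalSpace X] (T : X → X) : Prop :=
  (∃ x : X, Dense (Set.range fun n : ℕ => T^[n] x)) ∧ Dense (Function.periodicPts T)

/-- There is a vector whose orbit visits every nonempty open set along a set of times of positive
lower density. -/
def IsFrequentlyHypercyclic {X : Type*} [TopologicalSpace X] (T : X → X) : Prop :=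
  ∃ x : X, ∀ U : Set X, IsOpen U → U.Nonempty → 0 < lowerDensity {n : ℕ | T^[n] x ∈ U}

/-- The operator (continuous linear map) `T` on `c_0(A)` is the unilateral weighted shift
`B_w (x_n)_{n ≥ 0} = (w_{n+1} x_{n+1})_{n ≥ 0}` for a sequence `w` of positive reals. -/
structure IsWeightedShift {𝕜 : Type*} [RCLike 𝕜] {A : KotheMatrix} (w : ℕ → ℝ)
    (T : KotheC0 𝕜 A →L[𝕜] KotheC0 𝕜 A) : Prop where
  weight_pos : ∀ n, 0 < w n
  apply_coord : ∀ x n, (T x).coord n = (w (n + 1) : 𝕜) * x.coord (n + 1)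

end

/-!
A periodic point of `B_w` of period `m` with `x_0 ≠ 0` satisfies `w_1 ⋯ w_{mj} x_{mj} = x_0`, so
chaos would force `p ^ α_{mj} / (w_1 ⋯ w_{mj}) → 0` along some progression, for every `p`. But
continuity gives `w_n ≤ Q ^ α_n`, hence `w_1 ⋯ w_n ≤ Q ^ (α_1 + ⋯ + α_n)`, and shortly after a
jump `n = N_k + r` the sum in the exponent is at most `(r + 2) α_n`. Since the gaps of `N` tend to
infinity, the progression meets `[N_k, N_k + m)` for large `k`, where the quotient is at least `1`
for `p ≥ Q ^ (m + 1)`.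

For frequent hypercyclicity take `w_n = 2 ^ α_n`. If no jump occurs in `(k - c, k]`, then
`w_1 ⋯ w_k ≥ (2 ^ c) ^ α_k`, so that `p ^ α_k / (w_1 ⋯ w_k) ≤ p / 2 ^ c` as soon as `p ≤ 2 ^ c`.
It therefore suffices to find sets of visit times of positive lower density whose mutual
differences stay to the right of, and away from, the jumps. With jumps at `4 * 16 ^ s`, this holds
for the numbers `16 ^ u + 3 * 16 ^ l * j < 2 * 16 ^ u`, where `l` is the `2`-adic valuation of
`u`: differences between distinct blocks lie between `7 / 8 * 16 ^ u` and `4 * 16 ^ u`, and those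
within a block are multiples of `3 * 16 ^ l`, whereas `4 * 16 ^ s` is congruent to `16 ^ l` modulo
`3 * 16 ^ l` for `s ≥ l`.
-/

noncomputable section

/-! ### Köthe sequence spaces -/

namespace KotheC0

variable {𝕜 : Type*} [RCLike 𝕜] {A : KotheMatrix}

/-- The element of `c_0(A)` with given coordinates. -/
def ofSeq (f : ℕ → 𝕜) (hf : ∀ m : ℕ+, Tendsto (fun n => ‖f n‖ * A.a m n) atTop (𝓝 0)) :
    KotheC0 𝕜 A := ⟨f, hf⟩

@[simp]
theorem coord_ofSeq (f : ℕ → 𝕜)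
    (hf : ∀ m : ℕ+, Tendsto (fun n => ‖f n‖ * A.a m n) atTop (𝓝 0)) (n : ℕ) :
    (ofSeq f hf : KotheC0 𝕜 A).coord n = f n := rfl

theorem tendsto_coord (x : KotheC0 𝕜 A) (m : ℕ+) :
    Tendsto (fun n => ‖x.coord n‖ * A.a m n) atTop (𝓝 0) := x.2 m

@[ext]
theorem ext {x y : KotheC0 𝕜 A} (h : ∀ n, x.coord n = y.coord n) : x = y :=
  Subtype.ext (funext h)

@[simp]
theorem coord_add (x y : KotheC0 𝕜 A) (n : ℕ) : (x + y).coord n = x.coord n + y.coord n := rfl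

@[simp]
theorem coord_sub (x y : KotheC0 𝕜 A) (n : ℕ) : (x - y).coord n = x.coord n - y.coord n := rfl

@[simp]
theorem coord_smul (c : 𝕜) (x : KotheC0 𝕜 A) (n : ℕ) : (c • x).coord n = c * x.coord n := rfl

theorem norm_coord_mul_le_seminorm (x : KotheC0 𝕜 A) (m : ℕ+) (n : ℕ) :
    ‖x.coord n‖ * A.a m n ≤ seminorm 𝕜 A m x :=
  le_ciSup (bddAbove x m) n

theorem seminorm_le {x : KotheC0 𝕜 A} {m : ℕ+} {C : ℝ}
    (h : ∀ n, ‖x.coord n‖ * A.a m n ≤ C) : seminorm 𝕜 A m x ≤ C :=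
  ciSup_le h

theorem seminorm_mono : Monotone (seminorm 𝕜 A) := by
  intro m m' h x
  refine seminorm_le fun n => ?_
  have hA : A.a m n ≤ A.a m' n := by
    have hs : Monotone fun k : ℕ => A.a k.succPNat n :=
      monotone_nat_of_le_succ fun k => A.mono k.succPNat n
    simpa only [PNat.succPNat_natPred] using hs (PNat.natPred_le_natPred.2 h)
  exact (mul_le_mul_of_nonneg_left hA (norm_nonneg _)).trans (norm_coord_mul_le_seminorm x m' n)

theorem finset_sup_seminorm_le (s : Finset ℕ+) :
    s.sup (seminorm 𝕜 A) ≤ seminorm 𝕜 A (s.sup id) :=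
  Finset.sup_le fun _ hi => seminorm_mono (Finset.le_sup (f := id) hi)

theorem exists_seminorm_ball_subset {U : Set (KotheC0 𝕜 A)} (hU : IsOpen U)
    {x : KotheC0 𝕜 A} (hx : x ∈ U) :
    ∃ m : ℕ+, ∃ r > 0, ∀ z, seminorm 𝕜 A m (z - x) < r → z ∈ U := by
  obtain ⟨s, r, hr, hs⟩ := (withSeminorms.isOpen_iff_mem_balls U).1 hU x hx
  refine ⟨s.sup id, r, hr, fun z hz => hs ?_⟩
  rw [Seminorm.mem_ball]
  exact (finset_sup_seminorm_le s (z - x)).trans_lt hz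

theorem isOpen_coord_ne_zero (n : ℕ) : IsOpen {x : KotheC0 𝕜 A | x.coord n ≠ 0} := by
  rw [withSeminorms.isOpen_iff_mem_balls]
  intro x hx
  refine ⟨{1}, ‖x.coord n‖ * A.a 1 n, mul_pos (norm_pos_iff.2 hx) (A.pos 1 n), fun z hz hz0 => ?_⟩
  rw [Finset.sup_singleton, Seminorm.mem_ball] at hz
  have h := (norm_coord_mul_le_seminorm (z - x) 1 n).trans_lt hz
  simp [hz0] at h

/-- The `n`-th unit vector. -/
def unit (𝕜 : Type*) [RCLike 𝕜] (A : KotheMatrix) (n : ℕ) : KotheC0 𝕜 A :=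
  ofSeq (Pi.single n 1) fun m => by
    refine tendsto_const_nhds.congr' ?_
    filter_upwards [eventually_gt_atTop n] with k hk
    simp [hk.ne']

theorem coord_unit (n k : ℕ) : (unit 𝕜 A n).coord k = if k = n then 1 else 0 := by
  simp [unit, Pi.single_apply]

theorem seminorm_unit_le (m : ℕ+) (n : ℕ) : seminorm 𝕜 A m (unit 𝕜 A n) ≤ A.a m n := by
  refine seminorm_le fun k => ?_
  rw [coord_unit]
  split_ifs with h
  · simp [h]
  · simpa using (A.pos m n).le

theorem exists_dense_finsupp (𝕜 : Type*) [RCLike 𝕜] (A : KotheMatrix) :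
    ∃ c : ℕ → ℕ →₀ 𝕜, ∀ (x : KotheC0 𝕜 A) (m : ℕ+) (δ : ℝ), 0 < δ →
      ∃ s, ∀ k, ‖c s k - x.coord k‖ * A.a m k ≤ δ := by
  let truncation (i n : ℕ) : ℕ →₀ 𝕜 := Finsupp.onFinset (Finset.range n)
    (fun k => if k < n then TopologicalSpace.denseSeq (ℕ → 𝕜) i k else 0)
    (by simp +contextual)
  refine ⟨fun s => truncation s.unpair.1 s.unpair.2, fun x m δ hδ => ?_⟩
  obtain ⟨n, hn⟩ := eventually_atTop.1 ((x.tendsto_coord m).eventually_lt_const hδ)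
  have hopen : IsOpen {g : ℕ → 𝕜 | ∀ k ∈ Finset.range n, ‖g k - x.coord k‖ * A.a m k < δ} := by
    simp only [Set.ofPred_forall]
    exact isOpen_biInter_finset fun k _ => isOpen_lt (by fun_prop) continuous_const
  obtain ⟨i, hi⟩ := (TopologicalSpace.denseRange_denseSeq (ℕ → 𝕜)).exists_mem_open hopen
    ⟨x.coord, by simp [hδ]⟩
  refine ⟨Nat.pair i n, fun k => ?_⟩
  simp only [truncation, Nat.unpair_pair, Finsupp.onFinset_apply]
  split_ifs with hk
  · exact (hi k (Finset.mem_range.2 hk)).le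
  · simpa using (hn k (not_lt.1 hk)).le

end KotheC0

/-! ### Weighted shifts on Köthe sequence spaces -/

/-- The products `w_1 ⋯ w_n` of the weights of a weighted shift, indexed so that the unused weight
`w_0` does not enter. -/
def weightProd (w : ℕ → ℝ) (n : ℕ) : ℝ := ∏ i ∈ Finset.range n, w (i + 1)

theorem weightProd_zero (w : ℕ → ℝ) : weightProd w 0 = 1 := Finset.prod_range_zero _

theorem weightProd_succ (w : ℕ → ℝ) (n : ℕ) :
    weightProd w (n + 1) = weightProd w n * w (n + 1) := Finset.prod_range_succ _ _

theorem weightProd_pos {w : ℕ → ℝ} (hw : ∀ n, 0 < w n) (n : ℕ) : 0 < weightProd w n :=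
  Finset.prod_pos fun i _ => hw (i + 1)

theorem exists_isWeightedShift (𝕜 : Type*) [RCLike 𝕜] {A : KotheMatrix} {w : ℕ → ℝ}
    (hw : ∀ n, 0 < w n)
    (hA : ∀ m : ℕ+, ∃ q : ℕ+, ∃ C : ℝ, ∀ n, w (n + 1) * A.a m n ≤ C * A.a q (n + 1)) :
    ∃ T : KotheC0 𝕜 A →L[𝕜] KotheC0 𝕜 A, IsWeightedShift w T := by
  choose q C hC using hA
  have hcoord (x : KotheC0 𝕜 A) (m : ℕ+) (n : ℕ) :
      ‖(w (n + 1) : 𝕜) * x.coord (n + 1)‖ * A.a m n ≤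
        C m * (‖x.coord (n + 1)‖ * A.a (q m) (n + 1)) :=
    calc ‖(w (n + 1) : 𝕜) * x.coord (n + 1)‖ * A.a m n
        = ‖x.coord (n + 1)‖ * (w (n + 1) * A.a m n) := by
          rw [norm_mul, RCLike.norm_of_nonneg (hw _).le]
          ring
      _ ≤ ‖x.coord (n + 1)‖ * (C m * A.a (q m) (n + 1)) :=
          mul_le_mul_of_nonneg_left (hC m n) (norm_nonneg _)
      _ = C m * (‖x.coord (n + 1)‖ * A.a (q m) (n + 1)) := by ring
  have hlim (x : KotheC0 𝕜 A) (m : ℕ+) :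
      Tendsto (fun n => ‖(w (n + 1) : 𝕜) * x.coord (n + 1)‖ * A.a m n) atTop (𝓝 0) := by
    refine squeeze_zero (fun n => mul_nonneg (norm_nonneg _) (A.pos m n).le) (hcoord x m) ?_
    simpa only [mul_zero, Function.comp_apply] using
      ((x.tendsto_coord (q m)).comp (tendsto_add_atTop_nat 1)).const_mul (C m)
  let S : KotheC0 𝕜 A →ₗ[𝕜] KotheC0 𝕜 A :=
    { toFun x := KotheC0.ofSeq _ (hlim x)
      map_add' x y := by ext n; simp [mul_add]
      map_smul' c x := by ext n; simp [mul_left_comm] }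
  have hS : Seminorm.IsBounded (KotheC0.seminorm 𝕜 A) (KotheC0.seminorm 𝕜 A) S := by
    refine Seminorm.IsBounded.of_real fun m => ⟨{q m}, C m, fun x => ?_⟩
    rw [Finset.sup_singleton]
    refine KotheC0.seminorm_le fun n => (hcoord x m n).trans ?_
    have hC_nonneg : 0 ≤ C m :=
      nonneg_of_mul_nonneg_left ((mul_pos (hw 1) (A.pos m 0)).le.trans (hC m 0)) (A.pos (q m) 1)
    exact mul_le_mul_of_nonneg_left (KotheC0.norm_coord_mul_le_seminorm x _ _) hC_nonneg
  exact ⟨⟨S, KotheC0.withSeminorms.continuous_of_isBounded KotheC0.withSeminorms S hS⟩,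
    hw, fun x n => rfl⟩

namespace IsWeightedShift

variable {𝕜 : Type*} [RCLike 𝕜] {A : KotheMatrix} {w : ℕ → ℝ}
  {T : KotheC0 𝕜 A →L[𝕜] KotheC0 𝕜 A}

theorem exists_weight_mul_le (hT : IsWeightedShift w T) (m : ℕ+) :
    ∃ q : ℕ+, ∃ C : ℝ, ∀ n, w (n + 1) * A.a m n ≤ C * A.a q (n + 1) := by
  have hcont : Continuous ((KotheC0.seminorm 𝕜 A m).comp (T : KotheC0 𝕜 A →ₗ[𝕜] KotheC0 𝕜 A)) :=
    (KotheC0.withSeminorms.continuous_seminorm m).comp T.continuous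
  obtain ⟨s, C, -, hC⟩ := Seminorm.bound_of_continuous KotheC0.withSeminorms _ hcont
  refine ⟨s.sup id, C, fun n => ?_⟩
  let e := KotheC0.unit 𝕜 A (n + 1)
  calc w (n + 1) * A.a m n = ‖(T e).coord n‖ * A.a m n := by
        simp [e, hT.apply_coord, KotheC0.coord_unit, abs_of_pos (hT.weight_pos (n + 1))]
    _ ≤ KotheC0.seminorm 𝕜 A m (T e) := KotheC0.norm_coord_mul_le_seminorm _ _ _
    _ ≤ C * s.sup (KotheC0.seminorm 𝕜 A) e := hC e
    _ ≤ C * A.a (s.sup id) (n + 1) := mul_le_mul_of_nonneg_left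
        ((KotheC0.finset_sup_seminorm_le s e).trans (KotheC0.seminorm_unit_le _ _)) C.2

theorem weightProd_mul_coord_iterate (hT : IsWeightedShift w T) (x : KotheC0 𝕜 A) (n k : ℕ) :
    (weightProd w k : 𝕜) * (T^[n] x).coord k = (weightProd w (k + n) : 𝕜) * x.coord (k + n) := by
  induction n generalizing k with
  | zero => rfl
  | succ n ih =>
    rw [Function.iterate_succ_apply', hT.apply_coord, ← mul_assoc, ← RCLike.ofReal_mul,
      ← weightProd_succ, ih, add_right_comm, add_assoc]

theorem coord_iterate_of_coord_eq_div (hT : IsWeightedShift w T) {x : KotheC0 𝕜 A} {y : ℕ → 𝕜}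
    (hx : ∀ k, x.coord k = y k / (weightProd w k : 𝕜)) (n k : ℕ) :
    (T^[n] x).coord k = y (n + k) / (weightProd w k : 𝕜) := by
  have hv : ∀ k, (weightProd w k : 𝕜) ≠ 0 := fun k =>
    RCLike.ofReal_ne_zero.2 (weightProd_pos hT.weight_pos k).ne'
  rw [eq_div_iff (hv k), mul_comm, hT.weightProd_mul_coord_iterate, hx, mul_div_cancel₀ _ (hv _),
    add_comm]

/-! ### Chaotic weighted shifts -/

theorem weightProd_mul_norm_coord_of_isPeriodicPt (hT : IsWeightedShift w T) {x : KotheC0 𝕜 A}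
    {m : ℕ} (hx : Function.IsPeriodicPt T m x) (j : ℕ) :
    weightProd w (m * j) * ‖x.coord (m * j)‖ = ‖x.coord 0‖ := by
  have h := congrArg norm (hT.weightProd_mul_coord_iterate x (m * j) 0)
  rw [(hx.mul_const j).eq, zero_add, weightProd_zero, RCLike.ofReal_one, one_mul, norm_mul,
    RCLike.norm_of_nonneg (weightProd_pos hT.weight_pos _).le] at h
  exact h.symm

theorem exists_tendsto_div_weightProd_of_isChaotic (hT : IsWeightedShift w T) (h : IsChaotic T) :
    ∃ m > 0, ∀ p, Tendsto (fun j => A.a p (m * j) / weightProd w (m * j)) atTop (𝓝 0) := by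
  obtain ⟨x, hx0, m, hm, hx⟩ := h.2.inter_open_nonempty _
    (KotheC0.isOpen_coord_ne_zero (𝕜 := 𝕜) (A := A) 0)
    ⟨KotheC0.unit 𝕜 A 0, by simp [KotheC0.coord_unit]⟩
  refine ⟨m, hm, fun p => ?_⟩
  have hlim := ((x.tendsto_coord p).comp (tendsto_id.const_mul_atTop' hm)).div_const ‖x.coord 0‖
  rw [zero_div] at hlim
  refine hlim.congr fun j => ?_
  have hv := weightProd_pos hT.weight_pos (m * j)
  have hx0' : 0 < ‖x.coord 0‖ := norm_pos_iff.2 hx0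
  rw [Function.comp_apply, div_eq_div_iff hx0'.ne' hv.ne',
    ← hT.weightProd_mul_norm_coord_of_isPeriodicPt hx j, id]
  ring

end IsWeightedShift

/-! ### Lower density -/

theorem ncard_le_add_one (B : Set ℕ) (N : ℕ) : ({n | n ≤ N ∧ n ∈ B} : Set ℕ).ncard ≤ N + 1 := by
  calc ({n | n ≤ N ∧ n ∈ B} : Set ℕ).ncard ≤ (Set.Iic N).ncard :=
        Set.ncard_le_ncard (fun n hn => hn.1) (Set.finite_Iic N)
    _ = N + 1 := by rw [← Finset.coe_Iic, Set.ncard_coe_finset, Nat.card_Iic]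

theorem ncard_le_ncard_of_subset {B B' : Set ℕ} (hB : B ⊆ B') {N N' : ℕ} (hN : N ≤ N') :
    ({n | n ≤ N ∧ n ∈ B} : Set ℕ).ncard ≤ ({n | n ≤ N' ∧ n ∈ B'} : Set ℕ).ncard :=
  Set.ncard_le_ncard (fun _ hn => ⟨hn.1.trans hN, hB hn.2⟩)
    ((Set.finite_Iic N').subset fun _ hn => hn.1)

theorem isCoboundedUnder_ge_density (B : Set ℕ) :
    IsCoboundedUnder (· ≥ ·) atTop
      fun N : ℕ => (({n | n ≤ N ∧ n ∈ B} : Set ℕ).ncard : ℝ) / ((N : ℝ) + 1) := by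
  refine (isBoundedUnder_of ⟨1, fun N => ?_⟩).isCoboundedUnder_ge
  rw [div_le_one (by positivity)]
  exact_mod_cast ncard_le_add_one B N

theorem lowerDensity_mono {B B' : Set ℕ} (h : B ⊆ B') : lowerDensity B ≤ lowerDensity B' := by
  refine liminf_le_liminf (Eventually.of_forall fun N => ?_)
    (isBoundedUnder_of ⟨0, fun N => by positivity⟩) (isCoboundedUnder_ge_density B')
  exact div_le_div_of_nonneg_right (by exact_mod_cast ncard_le_ncard_of_subset h le_rfl)
    (by positivity)

theorem lowerDensity_pos_of_strictMono {B : Set ℕ} {b : ℕ → ℕ} (hb : StrictMono b) {δ : ℝ}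
    (hδ : 0 < δ) (h : ∀ t, δ * b (t + 1) ≤ ({n | n ≤ b t ∧ n ∈ B} : Set ℕ).ncard) :
    0 < lowerDensity B := by
  refine hδ.trans_le (le_liminf_of_le (isCoboundedUnder_ge_density B) ?_)
  filter_upwards [eventually_ge_atTop (b 0)] with N hN
  obtain ⟨t, ht, ht'⟩ := hb.exists_between_of_tendsto_atTop hb.tendsto_atTop
    (Nat.lt_succ_of_le hN)
  rw [le_div_iff₀ (by positivity)]
  calc δ * ((N : ℝ) + 1) ≤ δ * b (t + 1) := by gcongr; exact_mod_cast ht'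
    _ ≤ ({n | n ≤ b t ∧ n ∈ B} : Set ℕ).ncard := h t
    _ ≤ ({n | n ≤ N ∧ n ∈ B} : Set ℕ).ncard := by
        exact_mod_cast ncard_le_ncard_of_subset subset_rfl (Nat.le_of_lt_succ ht)

/-! ### A criterion for frequent hypercyclicity -/

section Criterion

open scoped Pointwise

/-- Sets of times `E l` at which an orbit can be steered to targets `x` that are supported on
`[0, l]` and satisfy `|v_k x_k| ≤ R l`, where `v_k = w_1 ⋯ w_k`; in the coordinates `v_k x_k` the
shift is the unweighted one. The sequence that carries a copy of the `l`-th target at each time in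
`E l` defines a vector of the space by `tail`, and by `cross` the copies that follow a visit at time
`n ∈ E l` do not disturb it. -/
structure IsVisitScheme (A : KotheMatrix) (v R : ℕ → ℝ) (E : ℕ → Set ℕ) : Prop where
  lowerDensity_pos : ∀ l, 0 < lowerDensity (E l)
  separated : ∀ ⦃l l'⦄, ∀ n ∈ E l, ∀ n' ∈ E l', ∀ i ≤ l, ∀ i' ≤ l', n + i = n' + i' →
    l = l' ∧ n = n'
  tail : ∀ m, ∀ δ > 0, ∀ᶠ k in atTop, ∀ l, k ∈ E l + Set.Iic l → R l * (A.a m k / v k) < δ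
  cross : ∀ m, ∀ δ > 0, ∀ᶠ l in atTop, ∀ n ∈ E l, ∀ d > l, ∀ l', n + d ∈ E l' + Set.Iic l' →
    R l' * (A.a m d / v d) < δ

theorem exists_frequently_eq_of_eventually {X : Type*} {P : X → ℕ → Prop} (c : ℕ → X) {x₀ : X}
    (h₀ : ∀ l, P x₀ l) (hc : ∀ s, ∀ᶠ l in atTop, P (c s) l) :
    ∃ f : ℕ → X, (∀ l, P (f l) l) ∧ ∀ s, ∃ᶠ l in atTop, f l = c s := by
  classical
  refine ⟨fun l => if P (c l.unpair.1) l then c l.unpair.1 else x₀, fun l => ?_, fun s => ?_⟩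
  · dsimp only
    split_ifs with h
    exacts [h, h₀ l]
  · have hpair : Tendsto (Nat.pair s) atTop atTop := tendsto_atTop_mono (Nat.right_le_pair s)
      tendsto_id
    refine hpair.frequently (Eventually.frequently ?_)
    filter_upwards [hpair.eventually (hc s)] with j hj
    rw [Nat.unpair_pair, if_pos hj]

theorem exists_targets (𝕜 : Type*) [RCLike 𝕜] (A : KotheMatrix) (v : ℕ → ℝ) {R : ℕ → ℝ}
    (hR : Tendsto R atTop atTop) :
    ∃ f : ℕ → ℕ →₀ 𝕜, (∀ l, ∀ i ∈ (f l).support, i ≤ l ∧ ‖(v i : 𝕜) * f l i‖ ≤ R l) ∧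
      ∀ (x : KotheC0 𝕜 A) (m : ℕ+) (δ : ℝ), 0 < δ →
        ∃ᶠ l in atTop, ∀ k, ‖f l k - x.coord k‖ * A.a m k ≤ δ := by
  obtain ⟨c, hc⟩ := KotheC0.exists_dense_finsupp 𝕜 A
  obtain ⟨f, hf, hfc⟩ := exists_frequently_eq_of_eventually
    (P := fun g l => ∀ i ∈ g.support, i ≤ l ∧ ‖(v i : 𝕜) * g i‖ ≤ R l) c (x₀ := 0) (by simp)
    fun s => (Filter.eventually_all_finset _).2 fun i _ =>
      (eventually_ge_atTop i).and (hR.eventually_ge_atTop _)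
  refine ⟨f, hf, fun x m δ hδ => ?_⟩
  obtain ⟨s, hs⟩ := hc x m δ hδ
  exact (hfc s).mono fun l hl => by rwa [hl]

theorem exists_superposition {X : Type*} [Zero X] {E : ℕ → Set ℕ}
    (hE : ∀ ⦃l l'⦄, ∀ n ∈ E l, ∀ n' ∈ E l', ∀ i ≤ l, ∀ i' ≤ l', n + i = n' + i' → l = l' ∧ n = n')
    (g : ℕ → ℕ → X) :
    ∃ y : ℕ → X, (∀ l, ∀ n ∈ E l, ∀ i ≤ l, y (n + i) = g l i) ∧
      ∀ k, y k ≠ 0 → ∃ l, k ∈ E l + Set.Iic l ∧ ∃ i, y k = g l i := by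
  have hex : ∀ k, ∃ z, (∀ l, ∀ n ∈ E l, ∀ i ≤ l, n + i = k → z = g l i) ∧
      (z ≠ 0 → ∃ l, k ∈ E l + Set.Iic l ∧ ∃ i, z = g l i) := by
    intro k
    by_cases hk : ∃ l, k ∈ E l + Set.Iic l
    · obtain ⟨l, n, hn, i, hi, rfl⟩ := hk
      refine ⟨g l i, fun l' n' hn' i' hi' h => ?_, fun _ => ⟨l, Set.add_mem_add hn hi, i, rfl⟩⟩
      obtain ⟨rfl, rfl⟩ := hE n' hn' n hn i' hi' i hi h
      rw [Nat.add_left_cancel h]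
    · refine ⟨0, fun l n hn i hi h => (hk ⟨l, ?_⟩).elim, fun h => (h rfl).elim⟩
      exact h ▸ Set.add_mem_add hn hi
  choose y hy hy' using hex
  exact ⟨y, fun l n hn i hi => hy _ l n hn i hi rfl, hy'⟩

variable {𝕜 : Type*} [RCLike 𝕜] {A : KotheMatrix} {v R : ℕ → ℝ} {E : ℕ → Set ℕ} {y : ℕ → 𝕜}

theorem norm_div_mul_lt {c : 𝕜} {v a r δ : ℝ} (hv : 0 < v) (ha : 0 < a) (hc : ‖c‖ ≤ r)
    (hr : r * (a / v) < δ) : ‖c / (v : 𝕜)‖ * a < δ :=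
  calc ‖c / (v : 𝕜)‖ * a = ‖c‖ * (a / v) := by
        rw [norm_div, RCLike.norm_of_nonneg hv.le]
        ring
    _ ≤ r * (a / v) := by gcongr
    _ < δ := hr

namespace IsVisitScheme

theorem tendsto_norm_div_mul (hE : IsVisitScheme A v R E) (hv : ∀ k, 0 < v k)
    (hy : ∀ k, y k ≠ 0 → ∃ l, k ∈ E l + Set.Iic l ∧ ‖y k‖ ≤ R l) (m : ℕ+) :
    Tendsto (fun k => ‖y k / (v k : 𝕜)‖ * A.a m k) atTop (𝓝 0) := by
  have hnonneg (k : ℕ) : 0 ≤ ‖y k / (v k : 𝕜)‖ * A.a m k :=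
    mul_nonneg (norm_nonneg _) (A.pos m k).le
  refine tendsto_order.2 ⟨fun δ hδ => .of_forall fun k => hδ.trans_le (hnonneg k), fun δ hδ => ?_⟩
  filter_upwards [hE.tail m δ hδ] with k hk
  rcases eq_or_ne (y k) 0 with h0 | h0
  · simpa [h0] using hδ
  · obtain ⟨l, hl, hle⟩ := hy k h0
    exact norm_div_mul_lt (hv k) (A.pos m k) hle (hk l hl)

theorem eventually_norm_shift_div_mul_lt (hE : IsVisitScheme A v R E) (hv : ∀ k, 0 < v k)
    (hy : ∀ k, y k ≠ 0 → ∃ l, k ∈ E l + Set.Iic l ∧ ‖y k‖ ≤ R l) (m : ℕ+) {δ : ℝ} (hδ : 0 < δ) :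
    ∀ᶠ l in atTop, ∀ n ∈ E l, ∀ d > l, ‖y (n + d) / (v d : 𝕜)‖ * A.a m d < δ := by
  filter_upwards [hE.cross m δ hδ] with l hl n hn d hd
  rcases eq_or_ne (y (n + d)) 0 with h0 | h0
  · simpa [h0] using hδ
  · obtain ⟨l', hl', hle⟩ := hy _ h0
    exact norm_div_mul_lt (hv d) (A.pos m d) hle (hl n hn d hd l' hl')

end IsVisitScheme

theorem IsWeightedShift.isFrequentlyHypercyclic {w : ℕ → ℝ} {T : KotheC0 𝕜 A →L[𝕜] KotheC0 𝕜 A}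
    (hT : IsWeightedShift w T) (hR : Tendsto R atTop atTop)
    (hE : IsVisitScheme A (weightProd w) R E) : IsFrequentlyHypercyclic T := by
  have hv := weightProd_pos hT.weight_pos
  obtain ⟨f, hf, hdense⟩ := exists_targets 𝕜 A (weightProd w) hR
  obtain ⟨y, hy, hy_ne⟩ :=
    exists_superposition hE.separated fun l i => (weightProd w i : 𝕜) * f l i
  have hy_le : ∀ k, y k ≠ 0 → ∃ l, k ∈ E l + Set.Iic l ∧ ‖y k‖ ≤ R l := by
    intro k hk
    obtain ⟨l, hl, i, hi⟩ := hy_ne k hk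
    rw [hi] at hk ⊢
    exact ⟨l, hl, (hf l i (Finsupp.mem_support_iff.2 (right_ne_zero_of_mul hk))).2⟩
  let x : KotheC0 𝕜 A := KotheC0.ofSeq _ (hE.tendsto_norm_div_mul hv hy_le)
  refine ⟨x, fun U hU ⟨z, hz⟩ => ?_⟩
  obtain ⟨m, r, hr, hball⟩ := KotheC0.exists_seminorm_ball_subset hU hz
  obtain ⟨l, htarget, hcross⟩ := ((hdense z m (r / 3) (by positivity)).and_eventually
    (hE.eventually_norm_shift_div_mul_lt hv hy_le m (δ := r / 3) (by positivity))).exists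
  refine (hE.lowerDensity_pos l).trans_le (lowerDensity_mono fun n hn => hball _ ?_)
  have herror : ∀ d, ‖y (n + d) / (weightProd w d : 𝕜) - f l d‖ * A.a m d ≤ r / 3 := by
    intro d
    rcases le_or_gt d l with hd | hd
    · rw [hy l n hn d hd, mul_div_cancel_left₀ _ (RCLike.ofReal_ne_zero.2 (hv d).ne'), sub_self,
        norm_zero, zero_mul]
      positivity
    · have hfd : f l d = 0 :=
        Finsupp.notMem_support_iff.1 fun h => hd.not_ge (hf l d h).1
      rw [hfd, sub_zero]
      exact (hcross n hn d hd).le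
  refine lt_of_le_of_lt (KotheC0.seminorm_le (C := r / 3 + r / 3) fun d => ?_) (by linarith)
  rw [KotheC0.coord_sub, hT.coord_iterate_of_coord_eq_div fun k => KotheC0.coord_ofSeq _ _ k]
  calc ‖y (n + d) / (weightProd w d : 𝕜) - z.coord d‖ * A.a m d
      ≤ (‖y (n + d) / (weightProd w d : 𝕜) - f l d‖ + ‖f l d - z.coord d‖) * A.a m d :=
        mul_le_mul_of_nonneg_right (norm_sub_le_norm_sub_add_norm_sub _ _ _) (A.pos m d).le
    _ ≤ r / 3 + r / 3 := by
        rw [add_mul]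
        exact add_le_add (herror d) (htarget d)

end Criterion

/-! ### Exponents that are constant between sparse jumps -/

/-- The sequence `N` avoids the interval `(k - c, k]`. The difference is moved to the other side, so
that `c ≤ k` is forced when `N` takes the value `0`. -/
def JumpFree (N : ℕ → ℕ) (c k : ℕ) : Prop := ∀ t, N t + c ≤ k ∨ k < N t

theorem JumpFree.mono {N : ℕ → ℕ} {c c' k : ℕ} (h : JumpFree N c k) (hc : c' ≤ c) :
    JumpFree N c' k :=
  fun t => (h t).imp_left (Nat.add_le_add_left hc _).trans

theorem JumpFree.eq_of_const {X : Type*} {N : ℕ → ℕ} {α : ℕ → X}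
    (hconst : ∀ n, n + 1 ∉ Set.range N → α (n + 1) = α n) {j c : ℕ} (h : JumpFree N c (j + c)) :
    α (j + c) = α j := by
  induction c with
  | zero => rfl
  | succ c ih =>
    rw [← add_assoc, hconst (j + c), ih fun t => by have := h t; omega]
    rintro ⟨t, ht⟩
    have := h t
    omega

/-- The exponents of the power series space: `α_0 = 1`, and `α_n` is `α_0 + ⋯ + α_{n-1}` if `n` is a
value of `N` and `α_{n-1}` otherwise. -/
def jumpExponent (N : ℕ → ℕ) : ℕ → ℝ
  | 0 => 1
  | n + 1 =>
    open Classical in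
    if n + 1 ∈ Set.range N then ∑ i : Fin (n + 1), jumpExponent N i else jumpExponent N n

namespace jumpExponent

variable {N : ℕ → ℕ}

theorem succ_of_mem {n : ℕ} (h : n + 1 ∈ Set.range N) :
    jumpExponent N (n + 1) = ∑ i ∈ Finset.range (n + 1), jumpExponent N i := by
  rw [jumpExponent, if_pos h, Finset.sum_range]

theorem succ_of_notMem {n : ℕ} (h : n + 1 ∉ Set.range N) :
    jumpExponent N (n + 1) = jumpExponent N n := by
  rw [jumpExponent, if_neg h]

theorem apply_jump {k : ℕ} (hk : N k ≠ 0) :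
    jumpExponent N (N k) = ∑ i ∈ Finset.range (N k), jumpExponent N i := by
  obtain ⟨n, hn⟩ := Nat.exists_eq_succ_of_ne_zero hk
  rw [hn, succ_of_mem ⟨k, hn⟩]

theorem le_succ_of_nonneg {n : ℕ} (h : ∀ i ≤ n, 0 ≤ jumpExponent N i) :
    jumpExponent N n ≤ jumpExponent N (n + 1) := by
  by_cases hn : n + 1 ∈ Set.range N
  · rw [succ_of_mem hn]
    exact Finset.single_le_sum (f := jumpExponent N)
      (fun i hi => h i (Finset.mem_range_succ_iff.1 hi)) (Finset.self_mem_range_succ n)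
  · exact (succ_of_notMem hn).ge

theorem one_le (n : ℕ) : 1 ≤ jumpExponent N n := by
  induction n using Nat.strong_induction_on with
  | _ n ih =>
    cases n with
    | zero => rw [jumpExponent]
    | succ n =>
      exact (ih n n.lt_succ_self).trans
        (le_succ_of_nonneg fun i hi => zero_le_one.trans (ih i (Nat.lt_succ_of_le hi)))

theorem pos (n : ℕ) : 0 < jumpExponent N n := zero_lt_one.trans_le (one_le n)

theorem monotone : Monotone (jumpExponent N) :=
  monotone_nat_of_le_succ fun _ => le_succ_of_nonneg fun i _ => (pos i).le

theorem tendsto_atTop (hN : StrictMono N) : Tendsto (jumpExponent N) atTop atTop := by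
  refine tendsto_atTop_atTop_of_monotone monotone fun b => ?_
  obtain ⟨n, hn⟩ := exists_nat_ge b
  have hle : n + 1 ≤ N (n + 1) := hN.le_apply
  refine ⟨N (n + 1), ?_⟩
  calc b ≤ N (n + 1) := hn.trans (by exact_mod_cast n.le_succ.trans hle)
    _ = ∑ _i ∈ Finset.range (N (n + 1)), (1 : ℝ) := by simp
    _ ≤ ∑ i ∈ Finset.range (N (n + 1)), jumpExponent N i := Finset.sum_le_sum fun _ _ => one_le _
    _ = jumpExponent N (N (n + 1)) := (apply_jump (by omega)).symm

end jumpExponent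

/-! ### Absence of chaos -/

theorem sum_range_succ_le_of_jumpFree {N : ℕ → ℕ} {α : ℕ → ℝ} (hα : 0 ≤ α 0)
    (hconst : ∀ n, n + 1 ∉ Set.range N → α (n + 1) = α n) {k r : ℕ}
    (hsum : α (N k) = ∑ i ∈ Finset.range (N k), α i) (h : JumpFree N r (N k + r)) :
    ∑ i ∈ Finset.range (N k + r), α (i + 1) ≤ (r + 2) * α (N k) :=
  have hα_eq : ∀ i ∈ Finset.range (r + 1), α (N k + i) = α (N k) := fun i hi =>
    JumpFree.eq_of_const hconst fun t => by
      have := Finset.mem_range.1 hi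
      have := h t
      omega
  calc ∑ i ∈ Finset.range (N k + r), α (i + 1)
      ≤ ∑ i ∈ Finset.range (N k + (r + 1)), α i := by
        rw [← add_assoc, Finset.sum_range_succ']
        exact le_add_of_nonneg_right hα
    _ = α (N k) + (r + 1 : ℕ) * α (N k) := by
        rw [Finset.sum_range_add, ← hsum, Finset.sum_congr rfl hα_eq, Finset.sum_const,
          Finset.card_range, nsmul_eq_mul]
    _ = (r + 2) * α (N k) := by
        push_cast
        ring

theorem weightProd_le_rpow_sum {w α : ℕ → ℝ} {Q : ℝ} (hw : ∀ n, 0 < w n) (hQ : 0 < Q)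
    (h : ∀ n, w (n + 1) ≤ Q ^ α (n + 1)) (n : ℕ) :
    weightProd w n ≤ Q ^ ∑ i ∈ Finset.range n, α (i + 1) := by
  rw [Real.rpow_sum_of_pos hQ]
  exact Finset.prod_le_prod (fun _ _ => (hw _).le) fun i _ => h i

theorem weightProd_le_rpow_of_jumpFree {w α : ℕ → ℝ} {Q : ℝ} (hw : ∀ n, 0 < w n) (hQ : 1 ≤ Q)
    (hwQ : ∀ n, w (n + 1) ≤ Q ^ α (n + 1)) {N : ℕ → ℕ} (hα : 0 ≤ α 0)
    (hconst : ∀ n, n + 1 ∉ Set.range N → α (n + 1) = α n) {k r : ℕ}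
    (hsum : α (N k) = ∑ i ∈ Finset.range (N k), α i) (h : JumpFree N r (N k + r)) :
    weightProd w (N k + r) ≤ (Q ^ (r + 2)) ^ α (N k + r) :=
  calc weightProd w (N k + r) ≤ Q ^ ∑ i ∈ Finset.range (N k + r), α (i + 1) :=
        weightProd_le_rpow_sum hw (zero_lt_one.trans_le hQ) hwQ _
    _ ≤ Q ^ ((r + 2 : ℕ) * α (N k + r)) := by
        rw [h.eq_of_const hconst]
        refine Real.rpow_le_rpow_of_exponent_le hQ ?_
        exact_mod_cast sum_range_succ_le_of_jumpFree hα hconst hsum h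
    _ = (Q ^ (r + 2)) ^ α (N k + r) := Real.rpow_natCast_mul (zero_le_one.trans hQ) _ _

theorem exists_mul_eq_add {m : ℕ} (hm : 0 < m) (n : ℕ) : ∃ j, ∃ r < m, m * j = n + r := by
  refine ⟨(n + (m - 1)) / m, m - 1 - (n + (m - 1)) % m, by omega, ?_⟩
  have := Nat.mod_lt (n + (m - 1)) hm
  have := Nat.div_add_mod (n + (m - 1)) m
  omega

namespace IsWeightedShift

variable {𝕜 : Type*} [RCLike 𝕜] {α : ℕ → ℝ} {hα : ∀ n, 0 < α n} {w : ℕ → ℝ}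
  {T : PowerSeriesC0 𝕜 α hα →L[𝕜] PowerSeriesC0 𝕜 α hα}

theorem exists_weight_le_rpow (hT : IsWeightedShift w T) (hα1 : ∀ n, 1 ≤ α n) :
    ∃ Q ≥ (1 : ℝ), ∀ n, w (n + 1) ≤ Q ^ α (n + 1) := by
  obtain ⟨q, C, hC⟩ := hT.exists_weight_mul_le 1
  have hC1 : 1 ≤ max C 1 := le_max_right C 1
  have hq : (1 : ℝ) ≤ (q : ℕ) := by exact_mod_cast q.pos
  refine ⟨max C 1 * (q : ℕ), one_le_mul_of_one_le_of_one_le hC1 hq, fun n => ?_⟩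
  calc w (n + 1) ≤ C * ((q : ℕ) : ℝ) ^ α (n + 1) := by simpa [powerSeriesMatrix] using hC n
    _ ≤ max C 1 ^ α (n + 1) * ((q : ℕ) : ℝ) ^ α (n + 1) := by
        gcongr
        exact (le_max_left C 1).trans (Real.self_le_rpow_of_one_le hC1 (hα1 _))
    _ = (max C 1 * (q : ℕ)) ^ α (n + 1) :=
        (Real.mul_rpow (zero_le_one.trans hC1) (zero_le_one.trans hq)).symm

theorem not_isChaotic {N : ℕ → ℕ} (hN : StrictMono N)
    (hgap : Tendsto (fun k => N (k + 1) - N k) atTop atTop) (hα1 : ∀ n, 1 ≤ α n)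
    (hsum : ∀ k, 1 ≤ k → α (N k) = ∑ i ∈ Finset.range (N k), α i)
    (hconst : ∀ n, n + 1 ∉ Set.range N → α (n + 1) = α n) (hT : IsWeightedShift w T) :
    ¬ IsChaotic T := by
  intro hchaos
  obtain ⟨m, hm, hlim⟩ := hT.exists_tendsto_div_weightProd_of_isChaotic hchaos
  obtain ⟨Q, hQ, hw⟩ := hT.exists_weight_le_rpow hα1
  obtain ⟨p, hp⟩ := exists_nat_ge (Q ^ (m + 1))
  have hp_pos : 0 < p := by exact_mod_cast (pow_pos (zero_lt_one.trans_le hQ) _).trans_le hp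
  obtain ⟨j₀, hj₀⟩ := eventually_atTop.1 ((hlim ⟨p, hp_pos⟩).eventually_lt_const zero_lt_one)
  obtain ⟨k, hk_gap, hk, hk_large⟩ := ((hgap.eventually_ge_atTop m).and
    ((eventually_ge_atTop 1).and (hN.tendsto_atTop.eventually_ge_atTop (m * j₀)))).exists
  obtain ⟨j, r, hr, hj⟩ := exists_mul_eq_add hm (N k)
  have hfree : JumpFree N r (N k + r) := by
    intro t
    rcases le_or_gt t k with ht | ht
    · exact .inl (Nat.add_le_add_right (hN.monotone ht) r)
    · have := hN.monotone (show k + 1 ≤ t from ht)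
      omega
  have hv : weightProd w (m * j) ≤ (p : ℝ) ^ α (m * j) :=
    calc weightProd w (m * j) ≤ (Q ^ (r + 2)) ^ α (m * j) := by
          rw [hj]
          exact weightProd_le_rpow_of_jumpFree hT.weight_pos hQ hw (hα 0).le hconst (hsum k hk)
            hfree
      _ ≤ (p : ℝ) ^ α (m * j) := Real.rpow_le_rpow (by positivity)
          ((pow_le_pow_right₀ hQ (by omega)).trans hp) (hα _).le
  have hlt := hj₀ j (Nat.le_of_mul_le_mul_left (hk_large.trans (by omega)) hm)
  rw [div_lt_one (weightProd_pos hT.weight_pos _)] at hlt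
  exact hlt.not_ge hv

end IsWeightedShift

/-! ### The shift with weights `2 ^ α_n` -/

section TwoRpowWeights

variable {α : ℕ → ℝ}

theorem two_rpow_mul_powerSeriesMatrix_le (hα : ∀ n, 0 < α n) (hmono : Monotone α) (m : ℕ+)
    (n : ℕ) : (2 : ℝ) ^ α (n + 1) * (powerSeriesMatrix α hα).a m n ≤
      (powerSeriesMatrix α hα).a (2 * m) (n + 1) := by
  have hm : (1 : ℝ) ≤ ((m : ℕ) : ℝ) := by exact_mod_cast m.pos
  calc (2 : ℝ) ^ α (n + 1) * ((m : ℕ) : ℝ) ^ α n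
      ≤ (2 : ℝ) ^ α (n + 1) * ((m : ℕ) : ℝ) ^ α (n + 1) := by
        gcongr
        exact hmono n.le_succ
    _ = (((2 * m : ℕ+) : ℕ) : ℝ) ^ α (n + 1) := by
        rw [← Real.mul_rpow zero_le_two (zero_le_one.trans hm)]
        push_cast
        rfl

variable {N : ℕ → ℕ} {c k p : ℕ}

theorem JumpFree.rpow_le_weightProd (hα : ∀ n, 0 ≤ α n)
    (hconst : ∀ n, n + 1 ∉ Set.range N → α (n + 1) = α n) (h : JumpFree N c k) (hck : c ≤ k) :
    ((2 : ℝ) ^ c) ^ α k ≤ weightProd (fun n => (2 : ℝ) ^ α n) k := by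
  obtain ⟨j, rfl⟩ := Nat.exists_eq_add_of_le' hck
  have hα_eq : ∀ i ∈ Finset.range c, α (j + i + 1) = α (j + c) := fun i hi => by
    have hic := Finset.mem_range.1 hi
    rw [h.eq_of_const hconst, add_assoc]
    exact JumpFree.eq_of_const hconst fun t => by have := h t; omega
  rw [weightProd, ← Real.rpow_sum_of_pos two_pos, ← Real.rpow_natCast_mul zero_le_two]
  refine Real.rpow_le_rpow_of_exponent_le one_le_two ?_
  rw [Finset.sum_range_add, Finset.sum_congr rfl hα_eq, Finset.sum_const, Finset.card_range,
    nsmul_eq_mul]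
  exact le_add_of_nonneg_left (Finset.sum_nonneg fun i _ => hα (i + 1))

theorem JumpFree.rpow_div_weightProd_le (hα : ∀ n, 1 ≤ α n)
    (hconst : ∀ n, n + 1 ∉ Set.range N → α (n + 1) = α n) (h : JumpFree N c k) (hck : c ≤ k)
    (hp : p ≤ 2 ^ c) :
    (p : ℝ) ^ α k / weightProd (fun n => (2 : ℝ) ^ α n) k ≤ p / 2 ^ c := by
  have hv := h.rpow_le_weightProd (fun n => zero_le_one.trans (hα n)) hconst hck
  have hp' : (p : ℝ) ≤ 2 ^ c := by exact_mod_cast hp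
  calc (p : ℝ) ^ α k / weightProd (fun n => (2 : ℝ) ^ α n) k
      ≤ (p : ℝ) ^ α k / ((2 : ℝ) ^ c) ^ α k := by gcongr
    _ = ((p : ℝ) / 2 ^ c) ^ α k := (Real.div_rpow (by positivity) (by positivity) _).symm
    _ ≤ p / 2 ^ c := by
        rcases Nat.eq_zero_or_pos p with rfl | hp0
        · simp [Real.zero_rpow (zero_lt_one.trans_le (hα k)).ne']
        · exact Real.rpow_le_self_of_le_one (by positivity)
            (div_le_one_of_le₀ hp' (by positivity)) (hα k)

theorem JumpFree.two_pow_mul_rpow_div_weightProd_le (hα : ∀ n, 1 ≤ α n)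
    (hconst : ∀ n, n + 1 ∉ Set.range N → α (n + 1) = α n) {l : ℕ} (h : JumpFree N (c + l) k)
    (hck : c + l ≤ k) (hp : p ≤ 2 ^ c) :
    2 ^ l * ((p : ℝ) ^ α k / weightProd (fun n => (2 : ℝ) ^ α n) k) ≤ p / 2 ^ c :=
  calc 2 ^ l * ((p : ℝ) ^ α k / weightProd (fun n => (2 : ℝ) ^ α n) k)
      ≤ 2 ^ l * (p / 2 ^ (c + l)) := by
        refine mul_le_mul_of_nonneg_left (h.rpow_div_weightProd_le hα hconst hck ?_) (by positivity)
        exact hp.trans (Nat.pow_le_pow_right two_pos (Nat.le_add_right c l))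
    _ = p / 2 ^ c := by
        rw [pow_add]
        field_simp

end TwoRpowWeights

/-! ### Jump times and visit times -/

/-- The times `N_k` at which the exponents jump, chosen so that, for every `l`, all but finitely
many of them are congruent to `16 ^ l` modulo `3 * 16 ^ l` and hence far from the multiples of
`3 * 16 ^ l`. -/
def jumpTime : ℕ → ℕ
  | 0 => 0
  | k + 1 => 4 * 16 ^ k

theorem strictMono_jumpTime : StrictMono jumpTime := by
  refine strictMono_nat_of_lt_succ fun k => ?_
  cases k with
  | zero => simp [jumpTime]
  | succ k =>
    have : 0 < 16 ^ k := by positivity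
    simp only [jumpTime, pow_succ]
    omega

theorem tendsto_jumpTime_sub : Tendsto (fun k => jumpTime (k + 1) - jumpTime k) atTop atTop := by
  refine tendsto_atTop_mono (fun k => ?_) tendsto_id
  cases k with
  | zero => exact Nat.zero_le _
  | succ k =>
    have : k < 16 ^ k := Nat.lt_pow_self (by norm_num)
    simp only [jumpTime, pow_succ, id]
    omega

theorem jumpFree_jumpTime_iff {c k : ℕ} :
    JumpFree jumpTime c k ↔ c ≤ k ∧ ∀ s, 4 * 16 ^ s + c ≤ k ∨ k < 4 * 16 ^ s := by
  refine ⟨fun h => ⟨by simpa [jumpTime] using h 0, fun s => h (s + 1)⟩, fun h t => ?_⟩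
  cases t with
  | zero => exact .inl (by simpa [jumpTime] using h.1)
  | succ s => exact h.2 s

theorem sixteen_mul_le_pow (u : ℕ) : 16 * u ≤ 16 ^ u := by
  cases u with
  | zero => simp
  | succ u =>
    have : u < 16 ^ u := Nat.lt_pow_self (by norm_num)
    rw [pow_succ]
    omega

theorem sixteen_mul_pow_le {s u : ℕ} (h : s < u) : 16 * 16 ^ s ≤ 16 ^ u := by
  rw [← pow_succ']
  exact Nat.pow_le_pow_right (by norm_num) h

theorem jumpFree_of_block {u d : ℕ} (h1 : 7 * 16 ^ u ≤ 8 * d) (h2 : d < 4 * 16 ^ u) :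
    JumpFree jumpTime (2 * u) d := by
  have hu := sixteen_mul_le_pow u
  refine jumpFree_jumpTime_iff.2 ⟨by omega, fun s => ?_⟩
  rcases le_or_gt u s with h | h
  · have : 16 ^ u ≤ 16 ^ s := Nat.pow_le_pow_right (by norm_num) h
    omega
  · have := sixteen_mul_pow_le h
    omega

theorem exists_four_mul_pow_eq (l s : ℕ) : ∃ q, 4 * 16 ^ (l + s) = 16 ^ l * (3 * q + 1) := by
  have hmod : 4 * 16 ^ s % 3 = 1 := by simp [Nat.mul_mod, Nat.pow_mod]
  refine ⟨4 * 16 ^ s / 3, ?_⟩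
  rw [pow_add, mul_left_comm, show 3 * (4 * 16 ^ s / 3) + 1 = 4 * 16 ^ s by omega]

theorem jumpFree_of_multiple {l j i : ℕ} (hj : 1 ≤ j) (hi : i ≤ l) :
    JumpFree jumpTime (2 * l) (3 * 16 ^ l * j + i) := by
  have hl := sixteen_mul_le_pow l
  have hjl : 16 ^ l ≤ 16 ^ l * j := Nat.le_mul_of_pos_right _ hj
  rw [mul_assoc]
  refine jumpFree_jumpTime_iff.2 ⟨by omega, fun s => ?_⟩
  rcases le_or_gt l s with h | h
  · obtain ⟨s, rfl⟩ := Nat.exists_eq_add_of_le h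
    obtain ⟨q, hq⟩ := exists_four_mul_pow_eq l s
    have hpos : 0 < 16 ^ l := by positivity
    rw [hq, mul_add_one, mul_left_comm]
    rcases le_or_gt j q with hjq | hjq
    · have := Nat.mul_le_mul_left (16 ^ l) hjq
      omega
    · have := Nat.mul_le_mul_left (16 ^ l) (Nat.succ_le_of_lt hjq)
      rw [Nat.mul_succ] at this
      omega
  · have := sixteen_mul_pow_le h
    omega

/-- The exponents `u` of the blocks `[16 ^ u, 2 * 16 ^ u)` devoted to the `l`-th target: those with
`2`-adic valuation `l`, so that the blocks of different targets are disjoint and those of one target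
recur with bounded ratio. -/
def blockExponent (l t : ℕ) : ℕ := 2 ^ l * (2 * t + 1)

theorem lt_blockExponent (l t : ℕ) : l < blockExponent l t :=
  Nat.lt_two_pow_self.trans_le (Nat.le_mul_of_pos_right _ (Nat.succ_pos _))

theorem blockExponent_succ (l t : ℕ) :
    blockExponent l (t + 1) = blockExponent l t + 2 ^ (l + 1) := by
  simp only [blockExponent]
  ring

theorem padicValNat_blockExponent (l t : ℕ) : padicValNat 2 (blockExponent l t) = l := by
  rw [blockExponent, padicValNat.mul (by positivity) (by omega), padicValNat.prime_pow,
    padicValNat.eq_zero_of_not_dvd (by omega), add_zero]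

/-- The times at which an orbit is to be close to the `l`-th target. -/
def visitTimes (l : ℕ) : Set ℕ :=
  {n | ∃ t j, 3 * 16 ^ l * j < 16 ^ blockExponent l t ∧
    n = 16 ^ blockExponent l t + 3 * 16 ^ l * j}

theorem log_of_block {u r : ℕ} (hr : r < 2 * 16 ^ u) : Nat.log 16 (16 ^ u + r) = u := by
  rw [Nat.log_eq_iff (Or.inr ⟨by norm_num, by positivity⟩), pow_succ]
  omega

theorem lt_two_mul_pow_blockExponent {l t j i : ℕ} (hj : 3 * 16 ^ l * j < 16 ^ blockExponent l t)
    (hi : i ≤ l) : 3 * 16 ^ l * j + i < 2 * 16 ^ blockExponent l t := by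
  have := lt_blockExponent l t
  have := sixteen_mul_le_pow (blockExponent l t)
  omega

theorem visitTimes_separated {l l' n n' i i' : ℕ} (hn : n ∈ visitTimes l)
    (hn' : n' ∈ visitTimes l') (hi : i ≤ l) (hi' : i' ≤ l') (h : n + i = n' + i') :
    l = l' ∧ n = n' := by
  obtain ⟨t, j, hj, rfl⟩ := hn
  obtain ⟨t', j', hj', rfl⟩ := hn'
  rw [add_assoc, add_assoc] at h
  have hu : blockExponent l t = blockExponent l' t' := by
    have hlog := congrArg (Nat.log 16) h
    rwa [log_of_block (lt_two_mul_pow_blockExponent hj hi),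
      log_of_block (lt_two_mul_pow_blockExponent hj' hi')] at hlog
  have hl : l = l' := by
    rw [← padicValNat_blockExponent l t, hu, padicValNat_blockExponent]
  subst hl
  rw [hu] at h ⊢
  have hlt : l < 3 * 16 ^ l := by
    have := sixteen_mul_le_pow l
    have : 0 < 16 ^ l := by positivity
    omega
  have hdiv := congrArg (· / (3 * 16 ^ l)) (Nat.add_left_cancel h)
  simp only [Nat.mul_add_div (Nat.zero_lt_of_lt hlt), Nat.div_eq_of_lt (hi.trans_lt hlt),
    Nat.div_eq_of_lt (hi'.trans_lt hlt), add_zero] at hdiv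
  exact ⟨rfl, by rw [hdiv]⟩

theorem le_ncard_visitTimes {l t s : ℕ} (hs : blockExponent l t = l + s + 1) :
    4 * 16 ^ s ≤ ({n | n ≤ 2 * 16 ^ blockExponent l t ∧ n ∈ visitTimes l} : Set ℕ).ncard := by
  let visit (j : ℕ) : ℕ := 16 ^ blockExponent l t + 3 * 16 ^ l * j
  have hinj : Function.Injective visit := fun a b hab =>
    Nat.eq_of_mul_eq_mul_left (show 0 < 3 * 16 ^ l by positivity) (Nat.add_left_cancel hab)
  rw [← Finset.card_range (4 * 16 ^ s), ← Finset.card_image_of_injective _ hinj,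
    ← Set.ncard_coe_finset]
  refine Set.ncard_le_ncard (fun n hn => ?_) ((Set.finite_Iic _).subset fun n hn => hn.1)
  obtain ⟨j, hj, rfl⟩ := Finset.mem_image.1 (Finset.mem_coe.1 hn)
  have hlt : 3 * 16 ^ l * j < 16 ^ blockExponent l t :=
    calc 3 * 16 ^ l * j ≤ 3 * 16 ^ l * (4 * 16 ^ s) :=
          Nat.mul_le_mul_left _ (Finset.mem_range.1 hj).le
      _ = 12 * 16 ^ (l + s) := by ring
      _ < 16 * 16 ^ (l + s) := by gcongr; norm_num
      _ = 16 ^ blockExponent l t := by rw [hs, pow_succ']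
  exact ⟨by simp only [visit]; omega, t, j, hlt, rfl⟩

theorem lowerDensity_visitTimes_pos (l : ℕ) : 0 < lowerDensity (visitTimes l) := by
  have hb : StrictMono fun t => 2 * 16 ^ blockExponent l t := by
    refine strictMono_nat_of_lt_succ fun t => ?_
    rw [blockExponent_succ]
    gcongr
    · norm_num
    · exact Nat.lt_add_of_pos_right (by positivity)
  refine lowerDensity_pos_of_strictMono hb (δ := 2 / (16 ^ (l + 1) * 16 ^ 2 ^ (l + 1)))
    (by positivity) fun t => ?_
  obtain ⟨s, hs⟩ := Nat.exists_eq_add_of_lt (lt_blockExponent l t)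
  calc (2 / (16 ^ (l + 1) * 16 ^ 2 ^ (l + 1)) : ℝ) * (2 * 16 ^ blockExponent l (t + 1) : ℕ)
      = (4 * 16 ^ s : ℕ) := by
        rw [blockExponent_succ, hs, add_right_comm l s 1, pow_add _ _ (2 ^ (l + 1)),
          pow_add _ (l + 1)]
        push_cast
        field_simp
        norm_num
    _ ≤ _ := by exact_mod_cast le_ncard_visitTimes hs

section VisitScheme

open scoped Pointwise

theorem jumpFree_two_mul_log {l k : ℕ} (hk : k ∈ visitTimes l + Set.Iic l) :
    l ≤ Nat.log 16 k ∧ JumpFree jumpTime (2 * Nat.log 16 k) k := by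
  obtain ⟨_, ⟨t, j, hj, rfl⟩, i, hi, rfl⟩ := hk
  have hlt := lt_two_mul_pow_blockExponent hj hi
  beta_reduce
  rw [add_assoc, log_of_block hlt]
  exact ⟨(lt_blockExponent l t).le, jumpFree_of_block (by omega) (by omega)⟩

theorem jumpFree_of_mem_visitTimes {l l' n d : ℕ} (hn : n ∈ visitTimes l) (hd : l < d)
    (hnd : n + d ∈ visitTimes l' + Set.Iic l') : JumpFree jumpTime (l + l') d := by
  obtain ⟨t, j, hj, rfl⟩ := hn
  obtain ⟨_, ⟨t', j', hj', rfl⟩, i, hi, h⟩ := hnd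
  have hlt := lt_two_mul_pow_blockExponent hj' hi
  have hl := lt_blockExponent l t
  have hl' := lt_blockExponent l' t'
  beta_reduce at h
  rcases lt_trichotomy (blockExponent l t) (blockExponent l' t') with hu | hu | hu
  · have := sixteen_mul_pow_le hu
    exact (jumpFree_of_block (u := blockExponent l' t') (by omega) (by omega)).mono (by omega)
  · obtain rfl : l = l' := by
      rw [← padicValNat_blockExponent l t, hu, padicValNat_blockExponent]
    rw [hu, add_assoc, add_assoc] at h
    rcases lt_or_ge j j' with hjj | hjj
    · obtain ⟨s, rfl⟩ := Nat.exists_eq_add_of_lt hjj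
      have hd_eq : d = 3 * 16 ^ l * (s + 1) + i := by
        rw [add_assoc j, mul_add, add_assoc] at h
        omega
      rw [hd_eq, ← two_mul]
      exact jumpFree_of_multiple s.succ_pos hi
    · have := Nat.mul_le_mul_left (3 * 16 ^ l) hjj
      rw [Set.mem_Iic] at hi
      omega
  · have := sixteen_mul_pow_le hu
    omega

theorem tendsto_div_two_pow (p : ℝ) : Tendsto (fun c : ℕ => p / 2 ^ c) atTop (𝓝 0) :=
  tendsto_const_nhds.div_atTop (tendsto_pow_atTop_atTop_of_one_lt one_lt_two)

theorem tendsto_log_atTop {b : ℕ} (hb : 1 < b) : Tendsto (Nat.log b) atTop atTop :=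
  tendsto_atTop_atTop_of_monotone Nat.log_monotone fun n => ⟨b ^ n, (Nat.log_pow hb n).ge⟩

theorem isVisitScheme_visitTimes {α : ℕ → ℝ} (hα : ∀ n, 0 < α n) (hα1 : ∀ n, 1 ≤ α n)
    (hconst : ∀ n, n + 1 ∉ Set.range jumpTime → α (n + 1) = α n) :
    IsVisitScheme (powerSeriesMatrix α hα) (weightProd fun n => (2 : ℝ) ^ α n) (fun l => 2 ^ l)
      visitTimes := by
  have hbound {m : ℕ+} {δ : ℝ} {c l k : ℕ} (hδ : ((m : ℕ) : ℝ) / 2 ^ c < δ) (hm : m ≤ c)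
      (h : JumpFree jumpTime (c + l) k) :
      2 ^ l * ((powerSeriesMatrix α hα).a m k / weightProd (fun n => (2 : ℝ) ^ α n) k) < δ :=
    (h.two_pow_mul_rpow_div_weightProd_le hα1 hconst (jumpFree_jumpTime_iff.1 h).1
      (hm.trans Nat.lt_two_pow_self.le)).trans_lt hδ
  have hsmall (m : ℕ+) {δ : ℝ} (hδ : 0 < δ) :
      ∀ᶠ c : ℕ in atTop, ((m : ℕ) : ℝ) / 2 ^ c < δ ∧ m ≤ c :=
    ((tendsto_div_two_pow _).eventually_lt_const hδ).and (eventually_ge_atTop _)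
  refine ⟨lowerDensity_visitTimes_pos, fun l l' n hn n' hn' i hi i' hi' h =>
    visitTimes_separated hn hn' hi hi' h, fun m δ hδ => ?_, fun m δ hδ => ?_⟩
  · have hlog : Tendsto (Nat.log 16) atTop atTop := tendsto_log_atTop (by norm_num)
    filter_upwards [hlog.eventually (hsmall m hδ)] with k hk l hkl
    obtain ⟨hl, hfree⟩ := jumpFree_two_mul_log hkl
    exact hbound hk.1 hk.2 (hfree.mono (by omega))
  · filter_upwards [hsmall m hδ] with l hl n hn d hd l' hnd
    exact hbound hl.1 hl.2 (jumpFree_of_mem_visitTimes hn hd hnd)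

end VisitScheme

theorem exists_isWeightedShift_isFrequentlyHypercyclic (𝕜 : Type*) [RCLike 𝕜] {α : ℕ → ℝ}
    (hα : ∀ n, 0 < α n) (hα1 : ∀ n, 1 ≤ α n) (hmono : Monotone α)
    (hconst : ∀ n, n + 1 ∉ Set.range jumpTime → α (n + 1) = α n) :
    ∃ (w : ℕ → ℝ) (T : PowerSeriesC0 𝕜 α hα →L[𝕜] PowerSeriesC0 𝕜 α hα),
      IsWeightedShift w T ∧ IsFrequentlyHypercyclic T := by
  obtain ⟨T, hT⟩ := exists_isWeightedShift 𝕜 (A := powerSeriesMatrix α hα)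
    (w := fun n => (2 : ℝ) ^ α n) (fun n => by positivity) fun m =>
      ⟨2 * m, 1, fun n => by simpa using two_rpow_mul_powerSeriesMatrix_le hα hmono m n⟩
  exact ⟨_, T, hT, hT.isFrequentlyHypercyclic (tendsto_pow_atTop_atTop_of_one_lt one_lt_two)
    (isVisitScheme_visitTimes hα hα1 hconst)⟩

end

theorem theorem1p2 (𝕜 : Type*) [RCLike 𝕜] :
    ∃ (N : ℕ → ℕ) (α : ℕ → ℝ) (hα : ∀ n, 0 < α n),
      -- the sparse sequence `N_0 < N_1 < ...`
      StrictMono N ∧ N 0 = 0 ∧ Tendsto (fun k => N (k + 1) - N k) atTop atTop ∧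
      -- the exponents are constant, except that they jump to the partial sums along `N`
      α 0 = 1 ∧
      (∀ k, 1 ≤ k → α (N k) = ∑ i ∈ Finset.range (N k), α i) ∧
      (∀ n, n + 1 ∉ Set.range N → α (n + 1) = α n) ∧
      -- they are admissible for a power series space of infinite type
      Monotone α ∧ Tendsto α atTop atTop ∧
      -- the Köthe space supports a frequently hypercyclic weighted shift
      (∃ (w : ℕ → ℝ) (T : PowerSeriesC0 𝕜 α hα →L[𝕜] PowerSeriesC0 𝕜 α hα),
        IsWeightedShift w T ∧ IsFrequentlyHypercyclic T) ∧
      -- but no chaotic weighted shift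
      (∀ (w : ℕ → ℝ) (T : PowerSeriesC0 𝕜 α hα →L[𝕜] PowerSeriesC0 𝕜 α hα),
        IsWeightedShift w T → ¬ IsChaotic T) := by
  have hN := strictMono_jumpTime
  have hsum (k : ℕ) (hk : 1 ≤ k) : jumpExponent jumpTime (jumpTime k) =
      ∑ i ∈ Finset.range (jumpTime k), jumpExponent jumpTime i :=
    jumpExponent.apply_jump (hN hk).ne_bot
  have hconst (n : ℕ) (hn : n + 1 ∉ Set.range jumpTime) :
      jumpExponent jumpTime (n + 1) = jumpExponent jumpTime n :=
    jumpExponent.succ_of_notMem hn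
  refine ⟨jumpTime, jumpExponent jumpTime, jumpExponent.pos, hN, rfl, tendsto_jumpTime_sub,
    by rw [jumpExponent], hsum, hconst, jumpExponent.monotone, jumpExponent.tendsto_atTop hN,
    ?_, ?_⟩
  · exact exists_isWeightedShift_isFrequentlyHypercyclic 𝕜 _ jumpExponent.one_le
      jumpExponent.monotone hconst
  · exact fun w T hT => hT.not_isChaotic hN tendsto_jumpTime_sub jumpExponent.one_le hsum hconst
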